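/- All matroids and polymatroids are finite, and polymatroids are integer-valued: a polymatroid $(E,\rho)$ is a function $\rho:2^E\to\mathbb Z_{\ge 0}$ that is normalized ($\rho(\emptyset)=0$), monotone and submodular. It is a $k$-polymatroid if $\rho(\{e\})\le k$ for all $e\in E$. Its minors are the polymatroids obtained by deletions $\rho\backslash D=\rho|_{E-D}$ and contractions $\rho/C$, $(\rho/C)(X)=\rho(X\cup C)-\rho(C)$. The $k$-natural matroid $M_\rho^k$ of a $k$-polymatroid $(E,\rho)$ has as ground set the disjoint union of sets $X_e$ ($e\in E$) with $|X_e|=k$, and its rank function is $$r(S)=\min\{\rho(A)+|S-X_A| : A\subseteq E\},\qquad X_A=\bigcup_{e\in A}X_e .$$ For a minor-closed class $\mathcal C$ of matroids, let $\mathcal C'_k$ be the minor-closed class of $k$-polymatroids $\rho$ with $M_\rho^k\in\mathcal C$. For a minor-closed class $\mathcal D$ of matroids or of polymatroids, $Ex(\mathcal D)$ denotes the set of its excluded minors, that is, of those matroids or polymatroids that are not in $\mathcal D$ while all their proper minors are in $\mathcal D$. A matroid is maximally separated if it is a direct sum of loops and coloops. **Theorem.** Let $a\ge 1$ and $b\ge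 2a$, and let $\mathcal C$ be the minor-closed class of matroids with $Ex(\mathcal C)=\{U_{a,b},U_{b-a,b}\}$ (up to isomorphism). Let $k\ge 2(b-a)$ and let $(E,\rho)\in Ex(\mathcal C'_k)$ with $|E|\ge 3$. Then $\rho$ has an $(a-1)$-corner decomposition: there are an $(a-1)$-polymatroid $\tau$ and a maximally separated matroid with rank function $r$, both on $E$, such that $$\rho=\tau+(k-(a-1))\,r .$$ -/

import Mathlib

universe u

/-! ### Matroids -/

namespace Matroid

/-- `M` is isomorphic to the uniform matroid `U_{a,b}` (`a ≤ b`): it has exactly `b` elements, and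
its independent sets are the sets of at most `a` elements. -/
def IsUniform {α : Type*} (M : Matroid α) (a b : ℕ) : Prop :=
  M.E.encard = b ∧ ∀ I ⊆ M.E, (M.Indep I ↔ I.encard ≤ a)

/-- Isomorphism of matroids: a bijection of the ground sets that carries the independent sets
of `M` to those of `N`. -/
def IsIsomorphic {α β : Type*} (M : Matroid α) (N : Matroid β) : Prop :=
  ∃ e : M.E ≃ N.E, M.mapSetEquiv e = N

/-- A matroid is maximally separated if each of its elements is a connected component, that is,
if it is a direct sum of loops and coloops. -/
def IsMaximallySeparated {α : Type*} (M : Matroid α) : Prop :=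
  ∀ e ∈ M.E, M.IsLoop e ∨ M.IsColoop e

end Matroid

/-- A minor-closed class of finite matroids (closed under isomorphism, as always). -/
structure MatroidClass where
  /-- membership in the class -/
  Mem : ∀ ⦃α : Type u⦄, Matroid α → Prop
  finite_of_mem : ∀ ⦃α : Type u⦄ (M : Matroid α), Mem M → M.Finite
  mem_of_isomorphic : ∀ ⦃α β : Type u⦄ (M : Matroid α) (N : Matroid β),
    M.IsIsomorphic N → Mem M → Mem N
  mem_of_isMinor : ∀ ⦃α : Type u⦄ (M N : Matroid α), N.IsMinor M → Mem M → Mem N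

/-- The finite matroid `M` is an excluded minor of the class `C`: it is not in `C`, but all its
proper minors are. -/
def MatroidClass.IsExcludedMinor (C : MatroidClass.{u}) {α : Type u} (M : Matroid α) : Prop :=
  M.Finite ∧ ¬ C.Mem M ∧ ∀ N : Matroid α, N.IsStrictMinor M → C.Mem N

/-! ### Polymatroids -/

/-- An (integer) polymatroid on a finite ground set: a normalized, monotone, submodular rank
function. As for matroids in Mathlib, the ground set is a set in an ambient type; the rank
function is extended to all sets `X` by `rk X = rk (X ∩ ground)`. -/
@[ext]
structure Polymatroid (α : Type*) where
  ground : Set α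
  rk : Set α → ℕ
  ground_finite : ground.Finite
  rk_inter_ground : ∀ X, rk (X ∩ ground) = rk X
  rk_empty : rk ∅ = 0
  rk_mono : ∀ ⦃X Y⦄, X ⊆ Y → rk X ≤ rk Y
  rk_submod : ∀ X Y, rk (X ∪ Y) + rk (X ∩ Y) ≤ rk X + rk Y

namespace Polymatroid

variable {α : Type*}

/-- `ρ` is a `k`-polymatroid: every element has rank at most `k`. -/
def IsKPolymatroid (ρ : Polymatroid α) (k : ℕ) : Prop :=
  ∀ e ∈ ρ.ground, ρ.rk {e} ≤ k

/-- The deletion `ρ \ D`. -/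
def delete (ρ : Polymatroid α) (D : Set α) : Polymatroid α where
  ground := ρ.ground \ D
  rk X := ρ.rk (X \ D)
  ground_finite := ρ.ground_finite.subset Set.sdiff_subset
  rk_inter_ground X := by
    rw [← ρ.rk_inter_ground (X \ D), ← ρ.rk_inter_ground ((X ∩ (ρ.ground \ D)) \ D)]
    congr 1
    ext x
    simp only [Set.mem_inter_iff, Set.mem_sdiff]
    tauto
  rk_empty := by simpa using ρ.rk_empty
  rk_mono X Y h := ρ.rk_mono (Set.sdiff_subset_sdiff_left h)
  rk_submod X Y := by
    have h := ρ.rk_submod (X \ D) (Y \ D)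
    have h1 : X \ D ∪ Y \ D = (X ∪ Y) \ D := by ext x; simp; tauto
    have h2 : X \ D ∩ (Y \ D) = (X ∩ Y) \ D := by ext x; simp; tauto
    rwa [h1, h2] at h

/-- The contraction `ρ / C`, with rank function `X ↦ ρ(X ∪ C) - ρ(C)`
(by monotonicity, the subtraction is never truncated). -/
def contract (ρ : Polymatroid α) (C : Set α) : Polymatroid α where
  ground := ρ.ground \ C
  rk X := ρ.rk (X ∪ C) - ρ.rk C
  ground_finite := ρ.ground_finite.subset Set.sdiff_subset
  rk_inter_ground X := by
    rw [← ρ.rk_inter_ground (X ∪ C), ← ρ.rk_inter_ground (X ∩ (ρ.ground \ C) ∪ C)]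
    congr 2
    ext x
    simp only [Set.mem_inter_iff, Set.mem_sdiff, Set.mem_union]
    tauto
  rk_empty := by simp
  rk_mono X Y h := Nat.sub_le_sub_right (ρ.rk_mono (Set.union_subset_union_left C h)) _
  rk_submod X Y := by
    have h := ρ.rk_submod (X ∪ C) (Y ∪ C)
    have h1 : X ∪ C ∪ (Y ∪ C) = X ∪ Y ∪ C := by ext x; simp; tauto
    have h2 : (X ∪ C) ∩ (Y ∪ C) = X ∩ Y ∪ C := by ext x; simp; tauto
    rw [h1, h2] at h
    have h3 : ρ.rk C ≤ ρ.rk (X ∩ Y ∪ C) := ρ.rk_mono Set.subset_union_right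
    have h4 : ρ.rk C ≤ ρ.rk (X ∪ Y ∪ C) := ρ.rk_mono Set.subset_union_right
    omega

/-- `σ` is a minor of `ρ`. -/
def IsMinor (σ ρ : Polymatroid α) : Prop :=
  ∃ C D : Set α, σ = (ρ.contract C).delete D

/-- `ρ` is an excluded minor of the class `P`: it is not in `P`, but all its proper minors are. -/
def IsExcludedMinor (P : Polymatroid α → Prop) (ρ : Polymatroid α) : Prop :=
  ¬ P ρ ∧ ∀ σ : Polymatroid α, σ.IsMinor ρ → σ ≠ ρ → P σ

/-! ### The `k`-natural matroid -/

/-- A set `I` of elements of `⋃ e, X_e`, where `X_e = {e} × {0, …, k-1}`, is independent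
in the `k`-natural matroid if `|I ∩ X_A| ≤ ρ(A)` for all `A`, where `X_A = ⋃ e ∈ A, X_e`. -/
def NaturalIndep (ρ : Polymatroid α) (k : ℕ) (I : Set (α × Fin k)) : Prop :=
  I ⊆ Prod.fst ⁻¹' ρ.ground ∧ ∀ A : Set α, (I ∩ Prod.fst ⁻¹' A).ncard ≤ ρ.rk A

theorem finite_preimage_ground (ρ : Polymatroid α) (k : ℕ) :
    (Prod.fst ⁻¹' ρ.ground : Set (α × Fin k)).Finite := by
  have h : (Prod.fst ⁻¹' ρ.ground : Set (α × Fin k)) = ρ.ground ×ˢ Set.univ := by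
    ext x; simp
  rw [h]
  exact ρ.ground_finite.prod Set.finite_univ

/-- The augmentation property of the independent sets of the `k`-natural matroid. -/
theorem naturalIndep_aug (ρ : Polymatroid α) (k : ℕ) {I J : Set (α × Fin k)}
    (hI : ρ.NaturalIndep k I) (hJ : ρ.NaturalIndep k J) (hlt : I.ncard < J.ncard) :
    ∃ e ∈ J, e ∉ I ∧ ρ.NaturalIndep k (insert e I) := by
  by_contra! hcon
  have hIf : I.Finite := (ρ.finite_preimage_ground k).subset hI.1
  have hJf : J.Finite := (ρ.finite_preimage_ground k).subset hJ.1
  -- unions of tight sets are tight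
  have hunion : ∀ A B : Set α, ρ.rk A ≤ (I ∩ Prod.fst ⁻¹' A).ncard →
      ρ.rk B ≤ (I ∩ Prod.fst ⁻¹' B).ncard →
      ρ.rk (A ∪ B) ≤ (I ∩ Prod.fst ⁻¹' (A ∪ B)).ncard := by
    intro A B hA hB
    have h1 := ρ.rk_submod A B
    have h2 := hI.2 (A ∩ B)
    have h3 := Set.ncard_union_add_ncard_inter (I ∩ Prod.fst ⁻¹' A) (I ∩ Prod.fst ⁻¹' B)
      (hIf.subset Set.inter_subset_left) (hIf.subset Set.inter_subset_left)
    rw [← Set.inter_union_distrib_left, ← Set.inter_inter_distrib_left,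
      ← Set.preimage_union, ← Set.preimage_inter] at h3
    omega
  -- every element of `J \ I` lies in a tight set
  have htight : ∀ e ∈ J, e ∉ I → ∃ A ⊆ ρ.ground, e.1 ∈ A ∧
      ρ.rk A ≤ (I ∩ Prod.fst ⁻¹' A).ncard := by
    intro e heJ heI
    have h := hcon e heJ heI
    simp only [NaturalIndep, not_and, not_forall, not_le] at h
    obtain ⟨A, hA⟩ := h (Set.insert_subset (hJ.1 heJ) hI.1)
    have heA : e.1 ∈ A := by
      by_contra heA
      rw [Set.insert_inter_of_notMem (by exact heA)] at hA
      exact absurd (hI.2 A) (not_le.2 hA)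
    refine ⟨A ∩ ρ.ground, Set.inter_subset_right, ⟨heA, hJ.1 heJ⟩, ?_⟩
    have heq : I ∩ Prod.fst ⁻¹' (A ∩ ρ.ground) = I ∩ Prod.fst ⁻¹' A := by
      ext x
      constructor
      · rintro ⟨h1, h2⟩; exact ⟨h1, h2.1⟩
      · rintro ⟨h1, h2⟩; exact ⟨h1, h2, hI.1 h1⟩
    rw [ρ.rk_inter_ground, heq]
    rw [Set.insert_inter_of_mem (by exact heA)] at hA
    have := Set.ncard_insert_le e (I ∩ Prod.fst ⁻¹' A)
    omega
  -- take a maximal tight set `T`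
  obtain ⟨T, ⟨hTE, hT⟩, hTmax⟩ := Set.Finite.exists_maximal
    (s := {A : Set α | A ⊆ ρ.ground ∧ ρ.rk A ≤ (I ∩ Prod.fst ⁻¹' A).ncard})
    (ρ.ground_finite.finite_subsets.subset fun A hA ↦ hA.1)
    ⟨∅, Set.empty_subset _, by simp [ρ.rk_empty]⟩
  have hJT : J \ I ⊆ Prod.fst ⁻¹' T := by
    rintro e ⟨heJ, heI⟩
    obtain ⟨A, hAE, heA, hA⟩ := htight e heJ heI
    exact hTmax ⟨Set.union_subset hTE hAE, hunion T A hT hA⟩ Set.subset_union_left (Or.inr heA)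
  have h1 := Set.ncard_inter_add_ncard_sdiff_eq_ncard I (Prod.fst ⁻¹' T) hIf
  have h2 := Set.ncard_inter_add_ncard_sdiff_eq_ncard J (Prod.fst ⁻¹' T) hJf
  have h3 : (J \ Prod.fst ⁻¹' T).ncard ≤ (I \ Prod.fst ⁻¹' T).ncard := by
    refine Set.ncard_le_ncard ?_ (hIf.subset Set.sdiff_subset)
    rintro e ⟨heJ, heT⟩
    exact ⟨by_contra fun heI ↦ heT (hJT ⟨heJ, heI⟩), heT⟩
  have h4 := hJ.2 T
  omega

/-- The `k`-natural matroid of `ρ`: each element `e` is replaced by a set `X_e` of `k` clones, and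
the rank of a set `S` is the minimum of `ρ(A) + |S \ X_A|` over all `A ⊆ ground`.
Equivalently, as it is put here, `S` is independent if and only if `|S ∩ X_A| ≤ ρ(A)`
for all `A`. -/
noncomputable def naturalMatroid (ρ : Polymatroid α) (k : ℕ) : Matroid (α × Fin k) :=
  (IndepMatroid.ofFinite (ρ.finite_preimage_ground k) (ρ.NaturalIndep k)
    ⟨Set.empty_subset _, fun A ↦ by simp⟩
    (fun I J hJ hIJ ↦ ⟨hIJ.trans hJ.1, fun A ↦
      (Set.ncard_le_ncard (Set.inter_subset_inter_left _ hIJ)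
        (((ρ.finite_preimage_ground k).subset hJ.1).subset Set.inter_subset_left)).trans
          (hJ.2 A)⟩)
    (fun _ _ hI hJ hIJ ↦ ρ.naturalIndep_aug k hI hJ hIJ)
    (fun _ hI ↦ hI.1)).matroid

/-- `ρ` has an `l`-corner decomposition (as a `k`-polymatroid): `ρ = τ + (k - l) r` for some
`l`-polymatroid `τ` and some maximally-separated matroid `r` on the same ground set. -/
def HasCornerDecomposition (ρ : Polymatroid α) (k l : ℕ) : Prop :=
  l ≤ k ∧ ∃ (τ : Polymatroid α) (r : Matroid α),
    τ.ground = ρ.ground ∧ r.E = ρ.ground ∧ τ.IsKPolymatroid l ∧ r.IsMaximallySeparated ∧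
    ∀ X ⊆ ρ.ground, (ρ.rk X : ℕ∞) = τ.rk X + ((k - l : ℕ) : ℕ∞) * r.eRk X

end Polymatroid

/-- Membership in the class of `k`-polymatroids induced by `C`: the `k`-polymatroids whose
`k`-natural matroid is in `C`. -/
def MatroidClass.MemInduced (C : MatroidClass.{u}) (k : ℕ) {α : Type u} (ρ : Polymatroid α) :
    Prop :=
  ρ.IsKPolymatroid k ∧ C.Mem (ρ.naturalMatroid k)

/-! Call the rank gained by adding `e` to a set its rank over that set. If each `e` has rank at most
`a - 1`, or rank at least `k - (a - 1)` over the other elements, then subtracting `k - (a - 1)` for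
each element of the second kind leaves an `(a - 1)`-polymatroid, and those elements are the coloops
of `r` (`hasCornerDecomposition_of_forall`). Suppose `e` violates this: its rank is at least `a`,
but at most `k - a` over the rest. The rank of `e` over a set falls as the set grows, so some single
`f` brings it to `k - a` or less while it is still at least `a` just before (`exists_rank_drop`).
Contracting the earlier set and keeping `e`, `f` gives a two-element minor, proper since `|E| ≥ 3`.
In its natural matroid, contracting suitable clones of `f` makes the `k` clones of `e` a uniform
matroid of rank between `a` and `k - a`, which contains `U_{a,b}` or `U_{b-a,b}`
(`exists_isMinor_naturalMatroid`), a contradiction. -/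

namespace Matroid

/-- Contracting an independent set below `X` and shrinking `X` turns a set whose independent
subsets are those of size at most `s` into a uniform minor. -/
theorem exists_isMinor_isUniform {β : Type*} (M : Matroid β) [M.Finite] {J X : Set β} {s m b : ℕ}
    (hX : X ⊆ M.E) (hXJ : Disjoint X J)
    (h : ∀ I ⊆ X, M.Indep (I ∪ J) ↔ I.ncard ≤ s) (hm : m ≤ s) (hb : s - m + b ≤ X.ncard) :
    ∃ N : Matroid β, N.IsMinor M ∧ N.IsUniform m b := by
  have hXf : X.Finite := M.ground_finite.subset hX
  -- Contracting `s - m` elements of `X` lowers the rank from `s` to `m`; any `b` of the remaining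
  -- elements then form the uniform minor.
  obtain ⟨K, hKX, hK⟩ := Set.exists_subset_card_eq (s := X) (n := s - m) (by omega)
  have hd := Set.ncard_sdiff_add_ncard_of_subset hKX hXf
  obtain ⟨B, hBX, hB⟩ := Set.exists_subset_card_eq (s := X \ K) (n := b) (by omega)
  have hKf := hXf.subset hKX
  have hKJ : M.Indep (K ∪ J) := (h K hKX).2 (by omega)
  have hBsub : B ⊆ X := hBX.trans Set.sdiff_subset
  have hBf := hXf.subset hBsub
  have hBK : Disjoint B K := Set.disjoint_of_subset_left hBX Set.disjoint_sdiff_left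
  have hBKJ : Disjoint B (K ∪ J) :=
    Set.disjoint_union_right.2 ⟨hBK, Set.disjoint_of_subset_left hBsub hXJ⟩
  have hE : ((M ／ (K ∪ J)) ＼ ((M.E \ (K ∪ J)) \ B)).E = B := by
    rw [delete_ground, contract_ground, Set.sdiff_sdiff_cancel_left]
    exact Set.subset_sdiff.2 ⟨hBsub.trans hX, hBKJ⟩
  refine ⟨_, M.contract_delete_isMinor (K ∪ J) ((M.E \ (K ∪ J)) \ B), ?_, ?_⟩
  · rw [hE, ← hBf.cast_ncard_eq, hB]
  · rw [hE]
    intro I hI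
    have hIf := hBf.subset hI
    have hcard := Set.ncard_union_eq (Set.disjoint_of_subset_left hI hBK) hIf hKf
    rw [delete_indep_iff, hKJ.contract_indep_iff, ← Set.union_assoc,
      h _ (Set.union_subset (hI.trans hBsub) hKX), ← hIf.cast_ncard_eq, Nat.cast_le]
    constructor
    · rintro ⟨⟨-, h1⟩, -⟩
      omega
    · intro h1
      exact ⟨⟨Set.disjoint_of_subset_left hI hBKJ, by omega⟩,
        Set.disjoint_of_subset_left hI Set.disjoint_sdiff_right⟩

end Matroid

namespace Polymatroid

variable {α : Type*}

/-! ### Natural matroids and two classes of clones -/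

instance naturalMatroid_finite (ρ : Polymatroid α) (k : ℕ) : (ρ.naturalMatroid k).Finite :=
  ⟨ρ.finite_preimage_ground k⟩

/-- Independence of sets of clones of only two elements. -/
theorem naturalMatroid_indep_union_iff (ρ : Polymatroid α) {k : ℕ} {e f : α} (hef : e ≠ f)
    (he : e ∈ ρ.ground) (hf : f ∈ ρ.ground) {P Q : Set (α × Fin k)}
    (hP : P ⊆ Prod.fst ⁻¹' {e}) (hQ : Q ⊆ Prod.fst ⁻¹' {f}) :
    (ρ.naturalMatroid k).Indep (P ∪ Q) ↔
      P.ncard ≤ ρ.rk {e} ∧ Q.ncard ≤ ρ.rk {f} ∧ P.ncard + Q.ncard ≤ ρ.rk {e, f} := by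
  have hPE : P ⊆ Prod.fst ⁻¹' ρ.ground :=
    hP.trans (Set.preimage_mono (Set.singleton_subset_iff.2 he))
  have hQE : Q ⊆ Prod.fst ⁻¹' ρ.ground :=
    hQ.trans (Set.preimage_mono (Set.singleton_subset_iff.2 hf))
  have hPf := (ρ.finite_preimage_ground k).subset hPE
  have hQf := (ρ.finite_preimage_ground k).subset hQE
  have hPQ : Disjoint P Q := by
    rw [Set.disjoint_left]
    intro x hx hx'
    exact hef ((hP hx).symm.trans (hQ hx'))
  have hcard := Set.ncard_union_eq hPQ hPf hQf
  have hin : ∀ {R : Set (α × Fin k)} {g : α} {A : Set α}, R ⊆ Prod.fst ⁻¹' {g} → g ∈ A →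
      R ∩ Prod.fst ⁻¹' A = R := fun hR hg ↦ Set.inter_eq_left.2
    (hR.trans (Set.preimage_mono (Set.singleton_subset_iff.2 hg)))
  have hout : ∀ {R : Set (α × Fin k)} {g : α} {A : Set α}, R ⊆ Prod.fst ⁻¹' {g} → g ∉ A →
      R ∩ Prod.fst ⁻¹' A = ∅ := fun {R g A} hR hg ↦ by
    rw [← Set.disjoint_iff_inter_eq_empty, Set.disjoint_left]
    intro x hx hxA
    have hxg : x.1 = g := hR hx
    exact hg (hxg ▸ hxA)
  change ρ.NaturalIndep k (P ∪ Q) ↔ _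
  constructor
  · rintro ⟨-, h⟩
    refine ⟨?_, ?_, ?_⟩
    · have := h {e}
      rwa [Set.union_inter_distrib_right, hin hP (Set.mem_singleton e), hout hQ (fun h ↦ hef h.symm),
        Set.union_empty] at this
    · have := h {f}
      rwa [Set.union_inter_distrib_right, hout hP (fun h ↦ hef h), hin hQ (Set.mem_singleton f),
        Set.empty_union] at this
    · have := h {e, f}
      rwa [Set.union_inter_distrib_right, hin hP (by simp), hin hQ (by simp), hcard] at this
  · rintro ⟨h1, h2, h3⟩
    refine ⟨Set.union_subset hPE hQE, fun A ↦ ?_⟩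
    rw [Set.union_inter_distrib_right]
    by_cases heA : e ∈ A <;> by_cases hfA : f ∈ A
    · rw [hin hP heA, hin hQ hfA, hcard]
      exact h3.trans (ρ.rk_mono (Set.pair_subset heA hfA))
    · rw [hin hP heA, hout hQ hfA, Set.union_empty]
      exact h1.trans (ρ.rk_mono (Set.singleton_subset_iff.2 heA))
    · rw [hout hP heA, hin hQ hfA, Set.empty_union]
      exact h2.trans (ρ.rk_mono (Set.singleton_subset_iff.2 hfA))
    · simp [hout hP heA, hout hQ hfA]

theorem ncard_clones (e : α) (k : ℕ) : (Prod.fst ⁻¹' {e} : Set (α × Fin k)).ncard = k := by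
  have h : (Prod.fst ⁻¹' {e} : Set (α × Fin k)) = {e} ×ˢ Set.univ := by
    ext x; simp
  rw [h, Set.ncard_prod]
  simp

/-- If the rank of `e` is at least `a`, and after contracting `f` it is at most `k - a`, then the
natural matroid has a minor `U_{a,b}` or `U_{b-a,b}`. -/
theorem exists_isMinor_naturalMatroid (ρ : Polymatroid α) {a b k : ℕ} (hb : 2 * a ≤ b)
    (hk : 2 * (b - a) ≤ k) (hρ : ρ.IsKPolymatroid k) {e f : α} (hef : e ≠ f)
    (he : e ∈ ρ.ground) (hf : f ∈ ρ.ground) (hea : a ≤ ρ.rk {e})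
    (hka : ρ.rk {e, f} + a ≤ ρ.rk {f} + k) :
    ∃ N : Matroid (α × Fin k), N.IsMinor (ρ.naturalMatroid k) ∧
      (N.IsUniform a b ∨ N.IsUniform (b - a) b) := by
  have hle : ρ.rk {e} ≤ ρ.rk {e, f} := ρ.rk_mono (by simp)
  have hfk := hρ f hf
  -- `s` is the rank left on the clones of `e` after contracting `j` clones of `f`. If the rank of
  -- `e` exceeds `k - a`, then `j` is chosen to bring it down to exactly `k - a`.
  obtain ⟨s, j, has, hsk, hj, hsj⟩ : ∃ s j, a ≤ s ∧ s + a ≤ k ∧ j ≤ ρ.rk {f} ∧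
      ∀ i, i ≤ ρ.rk {e} ∧ i + j ≤ ρ.rk {e, f} ↔ i ≤ s := by
    by_cases h : ρ.rk {e} + a ≤ k
    · exact ⟨ρ.rk {e}, 0, hea, h, by omega, fun i ↦ by omega⟩
    · exact ⟨k - a, ρ.rk {e, f} - (k - a), by omega, by omega, by omega, fun i ↦ by omega⟩
  obtain ⟨J, hJ, hJc⟩ := Set.exists_subset_card_eq
    (s := (Prod.fst ⁻¹' {f} : Set (α × Fin k))) (n := j) (by rw [ncard_clones]; omega)
  have hX : (Prod.fst ⁻¹' {e} : Set (α × Fin k)) ⊆ (ρ.naturalMatroid k).E :=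
    Set.preimage_mono (Set.singleton_subset_iff.2 he)
  have hXJ : Disjoint (Prod.fst ⁻¹' {e} : Set (α × Fin k)) J := by
    rw [Set.disjoint_left]
    intro x hx hx'
    exact hef (Eq.trans (Eq.symm hx) (hJ hx'))
  have h : ∀ I ⊆ (Prod.fst ⁻¹' {e} : Set (α × Fin k)),
      (ρ.naturalMatroid k).Indep (I ∪ J) ↔ I.ncard ≤ s := by
    intro I hI
    rw [ρ.naturalMatroid_indep_union_iff hef he hf hI hJ, ← hsj, hJc]
    tauto
  -- If this fails, then `s > k - (b - a) ≥ b - a`, so the rank is large enough for `U_{b-a,b}`; its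
  -- size fits because `s + a ≤ k`.
  by_cases hs : s + (b - a) ≤ k
  · obtain ⟨N, hN, hU⟩ := (ρ.naturalMatroid k).exists_isMinor_isUniform (m := a) (b := b)
      hX hXJ h has (by rw [ncard_clones]; omega)
    exact ⟨N, hN, Or.inl hU⟩
  · obtain ⟨N, hN, hU⟩ := (ρ.naturalMatroid k).exists_isMinor_isUniform (m := b - a) (b := b)
      hX hXJ h (by omega) (by rw [ncard_clones]; omega)
    exact ⟨N, hN, Or.inr hU⟩

/-! ### Marginal ranks and corner decompositions -/

/-- Diminishing returns: submodularity for `insert e A` and `B` shows that the rank of `e` over a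
set can only fall as the set grows. -/
theorem rk_union_le_of_subset (ρ : Polymatroid α) {A B : Set α} (hAB : A ⊆ B) {e : α}
    (he : e ∉ B) : ρ.rk (insert e B) + ρ.rk A ≤ ρ.rk (insert e A) + ρ.rk B := by
  have h := ρ.rk_submod (insert e A) B
  rwa [Set.insert_union, Set.union_eq_self_of_subset_left hAB, Set.insert_inter_of_notMem he,
    Set.inter_eq_self_of_subset_left hAB] at h

/-- If each element of `S` has rank at least `c` over all the others, then adding such elements
to a set raises the rank by at least `c` times their number. -/
theorem rk_add_mul_ncard_le (ρ : Polymatroid α) {S : Set α} {c : ℕ}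
    (hS : ∀ e ∈ S, ρ.rk (ρ.ground \ {e}) + c ≤ ρ.rk ρ.ground) (X T : Set α) (hT : T.Finite)
    (hTS : T ⊆ S) (hXT : Disjoint X T) : ρ.rk X + c * T.ncard ≤ ρ.rk (X ∪ T) := by
  induction T, hT using Set.Finite.induction_on with
  | empty => simp
  | @insert e T heT hT ih =>
    rw [Set.insert_subset_iff] at hTS
    rw [Set.disjoint_insert_right] at hXT
    have h1 := ih hTS.2 hXT.2
    have hc := hS e hTS.1
    have hsub : (X ∪ T) ∩ ρ.ground ⊆ ρ.ground \ {e} := by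
      rintro x ⟨hx, hxE⟩
      refine ⟨hxE, ?_⟩
      rintro rfl
      exact hx.elim hXT.1 heT
    have h2 := ρ.rk_union_le_of_subset hsub (e := e) (by simp)
    have h3 : ρ.rk ρ.ground ≤ ρ.rk (insert e (ρ.ground \ {e})) := ρ.rk_mono (by
      intro x hx
      by_cases hxe : x = e <;> simp [hx, hxe])
    have h4 : ρ.rk (insert e ((X ∪ T) ∩ ρ.ground)) ≤ ρ.rk (X ∪ insert e T) := ρ.rk_mono (by
      rw [Set.union_insert]
      exact Set.insert_subset_insert Set.inter_subset_left)
    rw [ρ.rk_inter_ground] at h2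
    rw [Set.ncard_insert_of_notMem heT hT, mul_add]
    omega

/-- An element of large rank over all others can be lowered by `k - l`, so `ρ` has a corner
decomposition as soon as every element has rank at most `l` or is of this kind. -/
theorem hasCornerDecomposition_of_forall (ρ : Polymatroid α) {k l : ℕ} (hlk : l ≤ k)
    (hρ : ρ.IsKPolymatroid k)
    (h : ∀ e ∈ ρ.ground, ρ.rk {e} ≤ l ∨ ρ.rk (ρ.ground \ {e}) + (k - l) ≤ ρ.rk ρ.ground) :
    ρ.HasCornerDecomposition k l := by
  set S : Set α := {e ∈ ρ.ground | ρ.rk (ρ.ground \ {e}) + (k - l) ≤ ρ.rk ρ.ground} with hS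
  have hSE : S ⊆ ρ.ground := fun e he ↦ he.1
  have hSf : S.Finite := ρ.ground_finite.subset hSE
  have hXSf : ∀ X : Set α, (X ∩ S).Finite := fun X ↦ hSf.subset Set.inter_subset_right
  -- This is monotonicity of `τ`, written without subtraction.
  have hinc : ∀ X Y : Set α, X ⊆ Y →
      ρ.rk X + (k - l) * (Y ∩ S).ncard ≤ ρ.rk Y + (k - l) * (X ∩ S).ncard := by
    intro X Y hXY
    have h1 := ρ.rk_add_mul_ncard_le (S := S) (fun e he ↦ he.2) X ((Y ∩ S) \ X)
      ((hXSf Y).subset Set.sdiff_subset) (fun x hx ↦ hx.1.2) Set.disjoint_sdiff_right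
    have h2 : ρ.rk (X ∪ (Y ∩ S) \ X) ≤ ρ.rk Y :=
      ρ.rk_mono (Set.union_subset hXY fun x hx ↦ hx.1.1)
    have h3 := Set.ncard_inter_add_ncard_sdiff_eq_ncard (Y ∩ S) X (hXSf Y)
    have h4 : (Y ∩ S) ∩ X = X ∩ S := by
      ext x
      exact ⟨fun hx ↦ ⟨hx.2, hx.1.2⟩, fun hx ↦ ⟨⟨hXY hx.1, hx.2⟩, hx.1⟩⟩
    rw [← h3, h4, mul_add]
    omega
  -- Ensures that the natural-number subtraction defining `τ` is never truncated.
  have hpos : ∀ X : Set α, (k - l) * (X ∩ S).ncard ≤ ρ.rk X := fun X ↦ by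
    simpa [ρ.rk_empty] using hinc ∅ X (Set.empty_subset X)
  let τ : Polymatroid α :=
    { ground := ρ.ground
      rk := fun X ↦ ρ.rk X - (k - l) * (X ∩ S).ncard
      ground_finite := ρ.ground_finite
      rk_inter_ground := fun X ↦ by
        rw [ρ.rk_inter_ground, Set.inter_assoc, Set.inter_eq_self_of_subset_right hSE]
      rk_empty := by simp [ρ.rk_empty]
      rk_mono := fun X Y hXY ↦ by
        have := hinc X Y hXY
        have := hpos X
        have := hpos Y
        show ρ.rk X - _ ≤ ρ.rk Y - _
        omega
      rk_submod := fun X Y ↦ by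
        have h1 := Set.ncard_union_add_ncard_inter (X ∩ S) (Y ∩ S) (hXSf X) (hXSf Y)
        rw [← Set.union_inter_distrib_right, ← Set.inter_inter_distrib_right] at h1
        have h2 := congrArg ((k - l) * ·) h1
        simp only [mul_add] at h2
        have := hpos X
        have := hpos Y
        have := hpos (X ∪ Y)
        have := hpos (X ∩ Y)
        have := ρ.rk_submod X Y
        omega }
  refine ⟨hlk, τ, Matroid.uniqueBaseOn S ρ.ground, rfl, rfl, ?_, ?_, ?_⟩
  · intro e he
    change ρ.rk {e} - (k - l) * ({e} ∩ S).ncard ≤ l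
    by_cases heS : e ∈ S
    · rw [Set.inter_eq_self_of_subset_left (Set.singleton_subset_iff.2 heS), Set.ncard_singleton]
      have := hρ e he
      omega
    · exact (Nat.sub_le _ _).trans ((h e he).resolve_right fun hc ↦ heS ⟨he, hc⟩)
  · intro e he
    by_cases heS : e ∈ S
    · refine Or.inr (Matroid.isColoop_iff_forall_mem_isBase.2 fun B hB ↦ ?_)
      rwa [(Matroid.uniqueBaseOn_isBase_iff hSE).1 hB]
    · exact Or.inl (Matroid.uniqueBaseOn_isLoop_iff.2 ⟨he, heS⟩)
  · intro X hX
    rw [(Matroid.uniqueBaseOn_inter_isBasis hX).eRk_eq_encard, ← (hXSf X).cast_ncard_eq]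
    change (ρ.rk X : ℕ∞) = ((ρ.rk X - (k - l) * (X ∩ S).ncard : ℕ) : ℕ∞) + _
    rw [← Nat.cast_mul, ← Nat.cast_add, Nat.sub_add_cancel (hpos X)]

/-! ### Locating a bad two-element minor -/

/-- The minor on `{e, f}` obtained by contracting `A`. -/
theorem exists_isMinor_pair (ρ : Polymatroid α) {A : Set α} {e f : α} (he : e ∈ ρ.ground)
    (hf : f ∈ ρ.ground) (heA : e ∉ A) (hfA : f ∉ A) :
    ∃ σ : Polymatroid α, σ.IsMinor ρ ∧ σ.ground = {e, f} ∧
      ∀ X ⊆ {e, f}, σ.rk X = ρ.rk (X ∪ A) - ρ.rk A := by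
  refine ⟨_, ⟨A, ρ.ground \ {e, f}, rfl⟩, ?_, fun X hX ↦ ?_⟩
  · ext x
    simp only [delete, contract, Set.mem_sdiff, Set.mem_insert_iff, Set.mem_singleton_iff]
    constructor
    · tauto
    · rintro (rfl | rfl) <;> tauto
  · have h : X \ (ρ.ground \ {e, f}) = X :=
      sdiff_eq_left.2 (Set.disjoint_of_subset_left hX Set.disjoint_sdiff_right)
    change ρ.rk (X \ (ρ.ground \ {e, f}) ∪ A) - ρ.rk A = _
    rw [h]

/-- If `e` has rank at least `t` but rank at most `t'` over all other elements, then there are a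
set `A` and an element `f` such that `e` still has rank at least `t` over `A`, and rank at most
`t'` over `A ∪ f`. -/
theorem exists_rank_drop (ρ : Polymatroid α) {t t' : ℕ} (htt : t ≤ t') {e g : α}
    (hg : g ∈ ρ.ground) (hge : g ≠ e) (ht : t ≤ ρ.rk {e})
    (ht' : ρ.rk ρ.ground ≤ ρ.rk (ρ.ground \ {e}) + t') :
    ∃ A f, f ∈ ρ.ground ∧ f ≠ e ∧ e ∉ A ∧ f ∉ A ∧ ρ.rk A + t ≤ ρ.rk (insert e A) ∧
      ρ.rk (insert e (insert f A)) ≤ ρ.rk (insert f A) + t' := by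
  have hEe : ρ.rk (insert e (ρ.ground \ {e})) ≤ ρ.rk (ρ.ground \ {e}) + t' := by
    by_cases he : e ∈ ρ.ground
    · rwa [Set.insert_sdiff_singleton, Set.insert_eq_of_mem he]
    · rw [← ρ.rk_inter_ground, Set.insert_inter_of_notMem he]
      exact (ρ.rk_mono Set.inter_subset_left).trans (Nat.le_add_right _ _)
  -- For a minimal `B` over which `e` has rank at most `t'`, removing any `f ∈ B` pushes that rank
  -- above `t' ≥ t`, so `A = B \ {f}` works. If `B` is empty, `A = ∅` works with any other element
  -- `g`.
  obtain ⟨B, ⟨hBE, hB⟩, hBmin⟩ := Set.Finite.exists_minimal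
    (s := {B : Set α | B ⊆ ρ.ground \ {e} ∧ ρ.rk (insert e B) ≤ ρ.rk B + t'})
    ((ρ.ground_finite.subset Set.sdiff_subset).finite_subsets.subset fun B hB ↦ hB.1)
    ⟨_, subset_rfl, hEe⟩
  rcases B.eq_empty_or_nonempty with rfl | ⟨f, hfB⟩
  · have h := ρ.rk_union_le_of_subset (Set.empty_subset {g}) (e := e)
      (fun h ↦ hge (Set.mem_singleton_iff.1 h).symm)
    refine ⟨∅, g, hg, hge, by simp, by simp, by simpa [ρ.rk_empty] using ht, ?_⟩
    simp only [LawfulSingleton.insert_empty_eq, ρ.rk_empty] at h hB ⊢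
    omega
  · refine ⟨B \ {f}, f, (hBE hfB).1, (hBE hfB).2, fun h ↦ (hBE h.1).2 rfl, fun h ↦ h.2 rfl, ?_, ?_⟩
    · by_contra! hlt
      have hmem : B \ {f} ∈ {B : Set α | B ⊆ ρ.ground \ {e} ∧ ρ.rk (insert e B) ≤ ρ.rk B + t'} :=
        ⟨Set.sdiff_subset.trans hBE, by omega⟩
      exact (hBmin hmem Set.sdiff_subset hfB).2 rfl
    · rwa [Set.insert_sdiff_singleton, Set.insert_eq_of_mem hfB]

end Polymatroid

theorem mainTheorem2 (a b k : ℕ) (ha : 1 ≤ a) (hb : 2 * a ≤ b) (hk : 2 * (b - a) ≤ k)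
    (C : MatroidClass.{u})
    (hC : ∀ {α : Type u} (M : Matroid α),
      C.IsExcludedMinor M ↔ M.IsUniform a b ∨ M.IsUniform (b - a) b)
    {α : Type u} (ρ : Polymatroid α)
    (hρ : Polymatroid.IsExcludedMinor (C.MemInduced k) ρ)
    (hcard : 3 ≤ ρ.ground.ncard) :
    ρ.HasCornerDecomposition k (a - 1) := by
  have hpair : ∀ {A : Set α} {e f : α}, e ∈ ρ.ground → f ∈ ρ.ground → e ∉ A → f ∉ A →
      ∃ σ : Polymatroid α, C.MemInduced k σ ∧ σ.ground = {e, f} ∧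
        ∀ X ⊆ {e, f}, σ.rk X = ρ.rk (X ∪ A) - ρ.rk A := by
    intro A e f he hf heA hfA
    obtain ⟨σ, hσ, hσE, hσr⟩ := ρ.exists_isMinor_pair he hf heA hfA
    refine ⟨σ, hρ.2 σ hσ ?_, hσE, hσr⟩
    -- The minor is proper: its ground set has at most two elements.
    rintro rfl
    have := Set.ncard_insert_le e {f}
    rw [hσE] at hcard
    rw [Set.ncard_singleton] at this
    omega
  have hne : ∀ e, ∃ g ∈ ρ.ground, g ≠ e := fun e ↦
    Set.exists_ne_of_one_lt_ncard (by omega) e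
  refine ρ.hasCornerDecomposition_of_forall (by omega) (fun e he ↦ ?_) (fun e he ↦ ?_)
  · obtain ⟨σ, hσ, hσE, hσr⟩ := hpair he he (Set.notMem_empty e) (Set.notMem_empty e)
    have h := hσ.1 e (by simp [hσE])
    rwa [hσr {e} (by simp), Set.union_empty, ρ.rk_empty, Nat.sub_zero] at h
  · by_contra! hcon
    obtain ⟨h1, h2⟩ := hcon
    obtain ⟨g, hg, hge⟩ := hne e
    -- The thresholds negate the two alternatives: more than `a - 1` is at least `a`, and less than
    -- `k - (a - 1)` is at most `k - a`. They satisfy `a ≤ k - a` because `k ≥ 2 * (b - a) ≥ 2 * a`.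
    obtain ⟨A, f, hf, hfe, heA, hfA, hA1, hA2⟩ := ρ.exists_rank_drop (t := a) (t' := k - a)
      (by omega) hg hge (by omega) (by omega)
    obtain ⟨σ, hσ, hσE, hσr⟩ := hpair he hf heA hfA
    have hAf : ρ.rk A ≤ ρ.rk (insert f A) := ρ.rk_mono (Set.subset_insert _ _)
    have hse : σ.rk {e} = ρ.rk (insert e A) - ρ.rk A := hσr {e} (by simp)
    have hsf : σ.rk {f} = ρ.rk (insert f A) - ρ.rk A := hσr {f} (by simp)
    have hsef : σ.rk {e, f} = ρ.rk (insert e (insert f A)) - ρ.rk A := by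
      rw [hσr _ subset_rfl, Set.insert_union, Set.singleton_union]
    obtain ⟨N, hN, hU⟩ := σ.exists_isMinor_naturalMatroid hb hk hσ.1 hfe.symm (by simp [hσE])
      (by simp [hσE]) (by omega) (by omega)
    exact ((hC N).2 hU).2.1 (C.mem_of_isMinor _ N hN hσ.2)
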